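/- Let $0<r<1$, let $\mathbb A_r=\{z\in\mathbb C: r<|z|<1\}$ with boundary $\partial\mathbb A_r=\mathbb T\cup r\mathbb T$, let $m\ge 2$, and let $b\mathbb A_r^m=(\partial\mathbb A_r)^m$ be the distinguished boundary of the polyannulus $\mathbb A_r^m\subset\mathbb C^m$. For every continuous function $f:b\mathbb A_r^m\to\mathbb R$ there is a unique continuous function $u:\overline{\mathbb A}_r^m\to\mathbb R$ such that $\Delta_j u=0$ in $\mathbb A_r^m$ for each $j=1,\dots,m$ (that is, $u$ is harmonic in each variable separately) and $u|_{b\mathbb A_r^m}=f$. Moreover, for $z\in\mathbb A_r^m$, $$u(z)=\sum_{\varepsilon\in\{1,r\}^m}\int_{\mathbb T^m} f(\varepsilon_1w_1,\dots,\varepsilon_mw_m)\prod_{j=1}^m P_A(z_j,\varepsilon_jw_j)\,d\sigma(w_1)\cdots d\sigma(w_m),$$ where $\sigma$ is normalized arc length on $\mathbb T$ and $P_A$ is the Poisson kernel of $\mathbb A_r$, given for $z\in\mathbb A_r$ and $w\in\mathbb T$ by $$P_A(z,w)=\frac{\log(|z|/r)}{\log(1/r)}+\sum_{k\ge1}\frac{1-(r/|z|)^{2k}}{1-r^{2k}}\,2\operatorname{Re}\big((z\overline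 w)^k\big),$$ $$P_A(z,rw)=\frac{\log|z|}{\log r}+\sum_{k\ge1}\Big(\frac{r}{|z|^{2}}\Big)^{k}\frac{1-|z|^{2k}}{1-r^{2k}}\,2\operatorname{Re}\big((z\overline w)^k\big).$$ -/

import Mathlib

open scoped ComplexConjugate

noncomputable section

/-- The annulus `𝔸_r = {z : r < |z| < 1}`. -/
def Annulus (r : ℝ) : Set ℂ := {z | r < ‖z‖ ∧ ‖z‖ < 1}

/-- The polyannulus `𝔸_r ^ m`. -/
def Polyannulus (r : ℝ) (m : ℕ) : Set (Fin m → ℂ) :=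
  Set.univ.pi fun _ => Annulus r

/-- The distinguished boundary `b𝔸_r ^ m = (∂𝔸_r) ^ m`. -/
def distinguishedBoundary (r : ℝ) (m : ℕ) : Set (Fin m → ℂ) :=
  Set.univ.pi fun _ => frontier (Annulus r)

/-- `Δ_j u = 0` in `𝔸_r ^ m` for every `j`: at every point `z` of the open polyannulus, the function
obtained from `u` by freezing all coordinates of `z` but the `j`-th one is harmonic at `z j`. -/
def SeparatelyHarmonic (r : ℝ) (m : ℕ) (u : (Fin m → ℂ) → ℝ) : Prop :=
  ∀ z ∈ Polyannulus r m, ∀ j : Fin m,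
    InnerProductSpace.HarmonicAt (fun ζ : ℂ => u (Function.update z j ζ)) (z j)

/-- `u` is a continuous function on the closed polyannulus that is harmonic in each variable in the
open polyannulus and agrees with `f` on the distinguished boundary. Only the values of `u` on the
closed polyannulus and of `f` on the distinguished boundary matter. -/
structure SolvesDirichlet (r : ℝ) (m : ℕ) (f u : (Fin m → ℂ) → ℝ) : Prop where
  continuousOn : ContinuousOn u (closure (Polyannulus r m))
  harmonic : SeparatelyHarmonic r m u
  eqOn_boundary : Set.EqOn u f (distinguishedBoundary r m)

/-- The Poisson kernel `P_A(z, w)` of `𝔸_r` for `z ∈ 𝔸_r` and the boundary point `w`, `|w| = 1`. -/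
def outerPoissonKernel (r : ℝ) (z w : ℂ) : ℝ :=
  Real.log (‖z‖ / r) / Real.log (1 / r) +
    ∑' k : ℕ, (1 - (r / ‖z‖) ^ (2 * (k + 1))) / (1 - r ^ (2 * (k + 1))) *
      (2 * ((z * conj w) ^ (k + 1)).re)

/-- The Poisson kernel `P_A(z, r w)` of `𝔸_r` for `z ∈ 𝔸_r` and the boundary point `r w`,
`|w| = 1`. -/
def innerPoissonKernel (r : ℝ) (z w : ℂ) : ℝ :=
  Real.log ‖z‖ / Real.log r +
    ∑' k : ℕ, (r / ‖z‖ ^ 2) ^ (k + 1) * (1 - ‖z‖ ^ (2 * (k + 1))) / (1 - r ^ (2 * (k + 1))) *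
      (2 * ((z * conj w) ^ (k + 1)).re)

/-- The point `(e^{iθ_1}, …, e^{iθ_m})` of the torus. -/
def torusPoint {m : ℕ} (θ : Fin m → ℝ) : Fin m → ℂ := fun j => Complex.exp (θ j * Complex.I)

/-- The point of `(∂𝔸_r) ^ m` over `w ∈ 𝕋 ^ m` whose coordinates with index in `s` are on the unit
circle and whose other coordinates are on the circle of radius `r`. -/
def boundaryPoint (r : ℝ) {m : ℕ} (s : Finset (Fin m)) (w : Fin m → ℂ) : Fin m → ℂ :=
  fun j => if j ∈ s then w j else (r : ℂ) * w j

/-- The product `∏ j, P_A(z_j, ζ_j)` of the kernels, where `ζ = boundaryPoint r s w`. -/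
def productPoissonKernel (r : ℝ) {m : ℕ} (s : Finset (Fin m)) (z w : Fin m → ℂ) : ℝ :=
  ∏ j, if j ∈ s then outerPoissonKernel r (z j) (w j) else innerPoissonKernel r (z j) (w j)

/-- The sum over the `2 ^ m` components of `(∂𝔸_r) ^ m` of the integrals of `f` against the products
of Poisson kernels, with respect to the normalized arc length measure on each circle. -/
def poissonIntegral (r : ℝ) {m : ℕ} (f : (Fin m → ℂ) → ℝ) (z : Fin m → ℂ) : ℝ :=
  ∑ s : Finset (Fin m), ((2 * Real.pi) ^ m)⁻¹ *
    ∫ θ in Set.univ.pi fun _ : Fin m => Set.Icc (0 : ℝ) (2 * Real.pi),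
      f (boundaryPoint r s (torusPoint θ)) * productPoissonKernel r s z (torusPoint θ)

end

open MeasureTheory Filter Topology Metric InnerProductSpace

/-! Explicit solutions exist for a dense set of boundary data, and a maximum principle turns
approximation of data into approximation of solutions.

On one annulus take the data `z ^ a * conj z ^ b`; by conjugation one may assume `b ≤ a`. Since
`|z|` is constant on each boundary circle, the data is there a multiple of `z ^ n` with `n = a - b`.
Its harmonic extension is a combination of `z ^ n` and `(conj z) ^ (-n)`, or of `1` and `log |z|`
when `n = 0`. The Fourier coefficients of `P_A` show that the extension is the Poisson integral of
its boundary values (`annulusPoisson_annulusMonomial`). Products of such functions in separate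
variables are separately harmonic, and Fubini gives them the product kernel
(`PolyannulusPoisson.prod`). By Stone–Weierstrass their linear combinations are uniformly dense on
the distinguished boundary.

Applying the one-variable maximum principle coordinate by coordinate bounds a solution by its values
on the distinguished boundary. This gives uniqueness, and makes solutions with uniformly convergent
data uniformly Cauchy on the closed polyannulus. The limit stays separately harmonic, and the
Poisson formula passes to the limit because the kernel at a fixed `z` is continuous on the torus.
Neither positivity of `P_A` nor its behaviour as `z` tends to the boundary is needed. -/

/-! ### Topology of the annulus, the polyannulus and its distinguished boundary. -/

theorem isOpen_annulus (r : ℝ) : IsOpen (Annulus r) :=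
  (isOpen_lt continuous_const continuous_norm).inter (isOpen_lt continuous_norm continuous_const)

theorem closure_annulus {r : ℝ} (hr0 : 0 < r) (hr1 : r < 1) :
    closure (Annulus r) = {z | r ≤ ‖z‖ ∧ ‖z‖ ≤ 1} := by
  apply subset_antisymm
  · apply closure_minimal
    · exact fun z hz => ⟨hz.1.le, hz.2.le⟩
    · exact (isClosed_le continuous_const continuous_norm).inter
        (isClosed_le continuous_norm continuous_const)
  · intro z hz
    have hz0 : ‖z‖ ≠ 0 := (hr0.trans_le hz.1).ne'
    have hc : ‖z‖ ∈ closure (Set.Ioo r 1) := by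
      rw [closure_Ioo hr1.ne]; exact hz
    have h := map_mem_closure (t := Annulus r) (f := fun t : ℝ => (t : ℂ) * (z / ‖z‖))
      (by fun_prop) hc (fun t ht => by
        have h0 : 0 < t := hr0.trans ht.1
        have h1 : ‖(t : ℂ) * (z / ‖z‖)‖ = t := by
          rw [norm_mul, norm_div, Complex.norm_real, Complex.norm_real, norm_norm, div_self hz0,
            mul_one, Real.norm_of_nonneg h0.le]
        exact ⟨ht.1.trans_eq h1.symm, h1.trans_lt ht.2⟩)
    have hz1 : (‖z‖ : ℂ) ≠ 0 := by exact_mod_cast hz0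
    simpa [mul_div_cancel₀ _ hz1] using h

theorem frontier_annulus {r : ℝ} (hr0 : 0 < r) (hr1 : r < 1) :
    frontier (Annulus r) = {z | ‖z‖ = r ∨ ‖z‖ = 1} := by
  rw [frontier, closure_annulus hr0 hr1, (isOpen_annulus r).interior_eq]
  ext z
  simp only [Annulus, Set.mem_sdiff, Set.mem_ofPred_eq, not_and, not_lt]
  constructor
  · rintro ⟨⟨h1, h2⟩, h3⟩
    rcases h1.eq_or_lt with h | h
    · exact Or.inl h.symm
    · exact Or.inr (le_antisymm h2 (h3 h))
  · rintro (h | h) <;> rw [h] <;> refine ⟨⟨?_, ?_⟩, fun _ => ?_⟩ <;> linarith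

theorem distinguishedBoundary_subset_closure (r : ℝ) (m : ℕ) :
    distinguishedBoundary r m ⊆ closure (Polyannulus r m) := by
  rw [Polyannulus, closure_pi_set]
  exact Set.pi_mono fun _ _ => frontier_subset_closure

theorem isCompact_closure_annulus {r : ℝ} (hr0 : 0 < r) (hr1 : r < 1) :
    IsCompact (closure (Annulus r)) := by
  refine (isCompact_closedBall (0 : ℂ) 1).of_isClosed_subset isClosed_closure ?_
  rw [closure_annulus hr0 hr1]
  intro z hz
  simpa using hz.2

theorem isCompact_closure_polyannulus {r : ℝ} (hr0 : 0 < r) (hr1 : r < 1) (m : ℕ) :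
    IsCompact (closure (Polyannulus r m)) := by
  rw [Polyannulus, closure_pi_set]
  exact isCompact_univ_pi fun _ => isCompact_closure_annulus hr0 hr1

theorem isCompact_distinguishedBoundary {r : ℝ} (hr0 : 0 < r) (hr1 : r < 1) (m : ℕ) :
    IsCompact (distinguishedBoundary r m) :=
  isCompact_univ_pi fun _ => (isCompact_closure_annulus hr0 hr1).of_isClosed_subset
    isClosed_frontier frontier_subset_closure

theorem norm_torusPoint {m : ℕ} (θ : Fin m → ℝ) (j : Fin m) : ‖torusPoint θ j‖ = 1 :=
  Complex.norm_exp_ofReal_mul_I _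

theorem boundaryPoint_torusPoint_mem {r : ℝ} (hr0 : 0 < r) (hr1 : r < 1) {m : ℕ}
    (s : Finset (Fin m)) (θ : Fin m → ℝ) :
    boundaryPoint r s (torusPoint θ) ∈ distinguishedBoundary r m := by
  intro j _
  rw [frontier_annulus hr0 hr1, boundaryPoint]
  split_ifs
  · exact Or.inr (norm_torusPoint θ j)
  · left
    simp [norm_torusPoint, abs_of_pos hr0]

theorem continuous_torusPoint (m : ℕ) : Continuous (torusPoint (m := m)) := by
  unfold torusPoint; fun_prop

theorem continuous_boundaryPoint (r : ℝ) {m : ℕ} (s : Finset (Fin m)) :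
    Continuous (boundaryPoint r s) := by
  refine continuous_pi fun j => ?_
  unfold boundaryPoint
  split_ifs <;> fun_prop

/-! ### Uniform limits of harmonic functions. -/

/-- Near the centre of a disc, the real part of the Herglotz integral of a continuous function on
the bounding circle is harmonic. -/
theorem harmonicAt_circleAverage_herglotzRieszKernel {u : ℂ → ℝ} {c : ℂ} {R : ℝ} (hR : 0 < R)
    (hu : ContinuousOn u (sphere c R)) :
    HarmonicAt (fun w => Real.circleAverage (Complex.re ∘ herglotzRieszKernel c w • u) c R) c := by
  have huc : ContinuousOn (fun ζ => 2 * (u ζ : ℂ)) (sphere c R) :=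
    continuousOn_const.mul (Complex.continuous_ofReal.comp_continuousOn hu)
  have hint : CircleIntegrable (fun ζ => 2 * (u ζ : ℂ)) c R := huc.circleIntegrable hR.le
  lift R to NNReal using hR.le
  have hF := hasFPowerSeriesOn_cauchy_integral hint (by exact_mod_cast hR)
  -- The Herglotz kernel is `2 (ζ - c) / (ζ - w) - 1`, so the average is the real part of a Cauchy
  -- integral, analytic in `w`, minus the mean of `u`.
  have hA := (hF.analyticAt.harmonicAt_re).sub
    (harmonicAt_const (Real.circleAverage u c R) (x := c))
  refine (harmonicAt_congr_nhds ?_).1 hA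
  filter_upwards [ball_mem_nhds c hR] with w hw
  have hne : ∀ ζ ∈ sphere c (R : ℝ), ζ - w ≠ 0 := by
    intro ζ hζ h
    rw [sub_eq_zero.1 h, mem_sphere] at hζ
    exact absurd (mem_ball.1 hw) (by rw [hζ]; exact lt_irrefl _)
  have hne' : ∀ ζ ∈ sphere c (R : ℝ), ζ - c ≠ 0 := by
    intro ζ hζ h
    rw [sub_eq_zero.1 h, mem_sphere, dist_self] at hζ
    exact hR.ne hζ
  have h1 : (2 * Real.pi * Complex.I : ℂ)⁻¹ • ∮ ζ in C(c, (R : ℝ)), (ζ - w)⁻¹ • (2 * (u ζ : ℂ)) =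
      Real.circleAverage (fun ζ => (ζ - c) * (ζ - w)⁻¹ * (2 * (u ζ : ℂ))) c R := by
    rw [Real.circleAverage_eq_circleIntegral hR.ne']
    congr 1
    apply circleIntegral.integral_congr hR.le
    intro ζ hζ
    have := hne' ζ hζ
    simp only [smul_eq_mul]
    field_simp
  have hint2 : CircleIntegrable (fun ζ => (ζ - c) * (ζ - w)⁻¹ * (2 * (u ζ : ℂ))) c R := by
    apply ContinuousOn.circleIntegrable hR.le
    refine ContinuousOn.mul (ContinuousOn.mul (by fun_prop) ?_) huc
    exact ContinuousOn.inv₀ (by fun_prop) hne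
  simp only [Pi.sub_apply]
  rw [h1, ← Complex.reCLM_apply, ← Complex.reCLM.circleAverage_comp_comm hint2,
    ← Real.circleAverage_sub]
  · apply Real.circleAverage_congr_sphere
    rw [abs_of_pos hR]
    intro ζ hζ
    have h2 := hne ζ hζ
    have h3 : herglotzRieszKernel c w ζ = 2 * ((ζ - c) * (ζ - w)⁻¹) - 1 := by
      rw [herglotzRieszKernel_def, sub_sub_sub_cancel_right]
      field_simp
      ring
    have h4 : (ζ - c) * (ζ - w)⁻¹ * (2 * (u ζ : ℂ)) =
        ((u ζ : ℝ) : ℂ) * (2 * ((ζ - c) * (ζ - w)⁻¹)) := by ring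
    simp only [Pi.sub_apply, Function.comp_apply, Complex.reCLM_apply, Pi.smul_apply', smul_eq_mul,
      h3, h4, Complex.re_ofReal_mul, Complex.sub_re, Complex.one_re]
    ring
  · apply ContinuousOn.circleIntegrable hR.le
    apply Complex.reCLM.continuous.comp_continuousOn
    refine ContinuousOn.mul (ContinuousOn.mul (by fun_prop) ?_) huc
    exact ContinuousOn.inv₀ (by fun_prop) hne
  · exact hu.circleIntegrable hR.le

theorem continuousOn_re_herglotzRieszKernel {c w : ℂ} {R : ℝ} (hw : w ∈ ball c R) :
    ContinuousOn (Complex.re ∘ herglotzRieszKernel c w) (sphere c R) := by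
  apply Complex.continuous_re.comp_continuousOn
  have h : ∀ ζ ∈ sphere c R, ζ - c - (w - c) ≠ 0 := by
    intro ζ hζ h
    rw [sub_sub_sub_cancel_right, sub_eq_zero] at h
    rw [h, mem_sphere] at hζ
    exact absurd (mem_ball.1 hw) (by rw [hζ]; exact lt_irrefl _)
  have : ContinuousOn (fun ζ => (ζ - c + (w - c)) / (ζ - c - (w - c))) (sphere c R) :=
    ContinuousOn.div (by fun_prop) (by fun_prop) h
  exact this.congr fun ζ _ => herglotzRieszKernel_def c w ζ

/-- A uniform limit of harmonic functions on a closed disc is harmonic at the centre. -/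
theorem TendstoUniformlyOn.harmonicAt {u : ℂ → ℝ} {v : ℕ → ℂ → ℝ} {c : ℂ} {R : ℝ} (hR : 0 < R)
    (hv : ∀ n, HarmonicOnNhd (v n) (closedBall c R))
    (h : TendstoUniformlyOn v u atTop (closedBall c R)) : HarmonicAt u c := by
  have hu : ContinuousOn u (closedBall c R) :=
    h.continuousOn (Eventually.of_forall fun n => (hv n).continuousOn).frequently
  have hus := hu.mono sphere_subset_closedBall
  refine (harmonicAt_congr_nhds ?_).1 (harmonicAt_circleAverage_herglotzRieszKernel hR hus)
  filter_upwards [ball_mem_nhds c hR] with w hw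
  have hk := continuousOn_re_herglotzRieszKernel hw
  obtain ⟨M, hM⟩ := (isCompact_sphere c R).exists_bound_of_continuousOn hk
  have hM0 : 0 ≤ M := by
    obtain ⟨ζ, hζ⟩ := NormedSpace.sphere_nonempty (x := c) (r := R) |>.2 hR.le
    exact (norm_nonneg _).trans (hM ζ hζ)
  refine tendsto_nhds_unique ?_ (h.tendsto_at (ball_subset_closedBall hw))
  -- Each `v n` is its own Herglotz average over the circle. Letting `n → ∞` under the integral, `u`
  -- equals its Herglotz average too.
  have heq : ∀ n, v n w = Real.circleAverage (Complex.re ∘ herglotzRieszKernel c w • v n) c R :=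
    fun n => ((hv n).circleAverage_re_herglotzRieszKernel_smul hw).symm
  simp_rw [heq, Real.circleAverage_def]
  refine Tendsto.const_smul ?_ ((2 * Real.pi)⁻¹ : ℝ)
  have hmem : ∀ θ, circleMap c R θ ∈ sphere c R := fun θ => circleMap_mem_sphere c hR.le θ
  have hcont : ∀ g : ℂ → ℝ, ContinuousOn g (sphere c R) → Continuous fun θ =>
      (Complex.re ∘ herglotzRieszKernel c w • g) (circleMap c R θ) := by
    intro g hg
    rw [← continuousOn_univ]
    exact ContinuousOn.comp (hk.smul hg) (continuous_circleMap c R).continuousOn fun θ _ => hmem θ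
  obtain ⟨B, hB⟩ := (isCompact_sphere c R).exists_bound_of_continuousOn hus
  have hev : ∀ᶠ n in atTop, ∀ ζ ∈ closedBall c R, dist (u ζ) (v n ζ) < 1 :=
    Metric.tendstoUniformlyOn_iff.1 h 1 one_pos
  apply intervalIntegral.tendsto_integral_filter_of_dominated_convergence (fun _ => M * (B + 1))
  · exact Eventually.of_forall fun n => (hcont _ ((hv n).continuousOn.mono
      sphere_subset_closedBall)).aestronglyMeasurable
  · filter_upwards [hev] with n hn
    refine Eventually.of_forall fun θ _ => ?_
    simp only [Pi.smul_apply', norm_smul]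
    refine mul_le_mul (hM _ (hmem θ)) ?_ (norm_nonneg _) hM0
    have h1 := hn _ (sphere_subset_closedBall (hmem θ))
    rw [dist_eq_norm] at h1
    have h2 := hB _ (hmem θ)
    have h3 := norm_sub_norm_le (v n (circleMap c R θ)) (u (circleMap c R θ))
    rw [norm_sub_rev] at h3
    linarith
  · exact intervalIntegrable_const
  · refine Eventually.of_forall fun θ _ => ?_
    exact tendsto_const_nhds.mul (h.tendsto_at (sphere_subset_closedBall (hmem θ)))

/-! ### Fourier coefficients of the kernels. -/

noncomputable section

/-- The real Fourier kernel `a₀ + ∑_{k ≥ 1} a_k · 2 Re((z w̄)^k)`. -/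
def fourierKernel (a : ℕ → ℝ) (z w : ℂ) : ℝ :=
  a 0 + ∑' k : ℕ, a (k + 1) * (2 * ((z * conj w) ^ (k + 1)).re)

end

theorem norm_fourierKernel_term_le (a : ℕ → ℝ) (z : ℂ) {w : ℂ} (hw : ‖w‖ = 1) (k : ℕ) :
    ‖a k * (2 * ((z * conj w) ^ k).re)‖ ≤ 2 * (|a k| * ‖z‖ ^ k) := by
  have h := Complex.abs_re_le_norm ((z * conj w) ^ k)
  rw [norm_pow, norm_mul, RCLike.norm_conj, hw, mul_one] at h
  rw [norm_mul, norm_mul, Real.norm_eq_abs, Real.norm_eq_abs, Real.norm_eq_abs, abs_two]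
  nlinarith [abs_nonneg (a k)]

theorem continuous_fourierKernel {a : ℕ → ℝ} {z : ℂ}
    (ha : Summable fun k => |a k| * ‖z‖ ^ k) {X : Type*} [TopologicalSpace X] {w : X → ℂ}
    (hw : Continuous w) (hw1 : ∀ x, ‖w x‖ = 1) : Continuous fun x => fourierKernel a z (w x) := by
  refine continuous_const.add (continuous_tsum (fun k => by fun_prop)
    (((summable_nat_add_iff 1).2 ha).mul_left 2) fun k x => ?_)
  exact norm_fourierKernel_term_le a z (hw1 x) (k + 1)

theorem integral_exp_pow_mul_conj_pow (n k : ℕ) :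
    ∫ θ in (0 : ℝ)..2 * Real.pi,
      Complex.exp (θ * Complex.I) ^ n * conj (Complex.exp (θ * Complex.I)) ^ k =
      if n = k then (2 * Real.pi : ℂ) else 0 := by
  have h : ∀ θ : ℝ, Complex.exp (θ * Complex.I) ^ n * conj (Complex.exp (θ * Complex.I)) ^ k =
      Complex.exp (((n : ℂ) - k) * Complex.I * θ) := by
    intro θ
    rw [← Complex.exp_conj, map_mul, Complex.conj_ofReal, Complex.conj_I, ← Complex.exp_nat_mul,
      ← Complex.exp_nat_mul, ← Complex.exp_add]
    ring_nf
  simp_rw [h]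
  split_ifs with hnk
  · simp [hnk]
  · have hc : ((n : ℂ) - k) * Complex.I ≠ 0 :=
      mul_ne_zero (sub_ne_zero.2 (by exact_mod_cast hnk)) Complex.I_ne_zero
    rw [integral_exp_mul_complex hc]
    have h2 : Complex.exp (((n : ℂ) - k) * Complex.I * (2 * Real.pi : ℝ)) = 1 := by
      rw [Complex.exp_eq_one_iff]
      exact ⟨(n : ℤ) - k, by push_cast; ring⟩
    rw [h2]
    simp

/-- Write `2 Re x = x + conj x`. The conjugate half has total frequency `n + k + 1 ≠ 0` and
integrates to zero; orthogonality settles the other half. -/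
theorem integral_exp_pow_mul_fourierKernel_term (a : ℝ) (z : ℂ) (n k : ℕ) :
    ∫ θ in (0 : ℝ)..2 * Real.pi, Complex.exp (θ * Complex.I) ^ n *
      ((a * (2 * ((z * conj (Complex.exp (θ * Complex.I))) ^ (k + 1)).re) : ℝ) : ℂ) =
      if n = k + 1 then 2 * Real.pi * (a * z ^ n) else 0 := by
  have h : ∀ θ : ℝ, Complex.exp (θ * Complex.I) ^ n *
      ((a * (2 * ((z * conj (Complex.exp (θ * Complex.I))) ^ (k + 1)).re) : ℝ) : ℂ) =
      a * z ^ (k + 1) * (Complex.exp (θ * Complex.I) ^ n *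
        conj (Complex.exp (θ * Complex.I)) ^ (k + 1)) +
      a * conj z ^ (k + 1) * (Complex.exp (θ * Complex.I) ^ (n + (k + 1)) *
        conj (Complex.exp (θ * Complex.I)) ^ 0) := by
    intro θ
    rw [Complex.ofReal_mul, ← Complex.add_conj]
    simp only [map_pow, map_mul, Complex.conj_conj]
    ring
  simp_rw [h]
  rw [intervalIntegral.integral_add, intervalIntegral.integral_const_mul,
    intervalIntegral.integral_const_mul, integral_exp_pow_mul_conj_pow,
    integral_exp_pow_mul_conj_pow]
  · rw [if_neg (show n + (k + 1) ≠ 0 by omega)]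
    split_ifs with hn
    · rw [hn]; ring
    · simp
  · exact (by fun_prop : Continuous _).intervalIntegrable _ _
  · exact (by fun_prop : Continuous _).intervalIntegrable _ _

/-- The nonnegative Fourier coefficients of the Fourier kernel. -/
theorem integral_exp_pow_mul_fourierKernel {a : ℕ → ℝ} {z : ℂ}
    (ha : Summable fun k => |a k| * ‖z‖ ^ k) (n : ℕ) :
    ∫ θ in (0 : ℝ)..2 * Real.pi, Complex.exp (θ * Complex.I) ^ n *
      (fourierKernel a z (Complex.exp (θ * Complex.I)) : ℂ) = 2 * Real.pi * (a n * z ^ n) := by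
  have hsum := (summable_nat_add_iff 1).2 ha
  have hnorm : ∀ θ : ℝ, ‖Complex.exp (θ * Complex.I)‖ = 1 := Complex.norm_exp_ofReal_mul_I
  have hcont : Continuous fun θ : ℝ => Complex.exp (θ * Complex.I) := by fun_prop
  have hterm : ∀ (θ : ℝ) (k : ℕ), ‖Complex.exp (θ * Complex.I) ^ n *
      ((a (k + 1) * (2 * ((z * conj (Complex.exp (θ * Complex.I))) ^ (k + 1)).re) : ℝ) : ℂ)‖ ≤
      2 * (|a (k + 1)| * ‖z‖ ^ (k + 1)) := by
    intro θ k
    rw [norm_mul, norm_pow, hnorm, one_pow, one_mul, Complex.norm_real]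
    exact norm_fourierKernel_term_le a z (hnorm θ) (k + 1)
  have hS := intervalIntegral.hasSum_integral_of_dominated_convergence
    (μ := volume) (a := 0) (b := 2 * Real.pi)
    (F := fun k θ => Complex.exp (θ * Complex.I) ^ n *
      ((a (k + 1) * (2 * ((z * conj (Complex.exp (θ * Complex.I))) ^ (k + 1)).re) : ℝ) : ℂ))
    (f := fun θ => Complex.exp (θ * Complex.I) ^ n *
      ((fourierKernel a z (Complex.exp (θ * Complex.I)) - a 0 : ℝ) : ℂ))
    (fun k _ => 2 * (|a (k + 1)| * ‖z‖ ^ (k + 1)))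
    (fun k => (by fun_prop : Continuous _).aestronglyMeasurable)
    (fun k => Eventually.of_forall fun θ _ => hterm θ k)
    (Eventually.of_forall fun θ _ => hsum.mul_left 2)
    intervalIntegrable_const
    (Eventually.of_forall fun θ _ => by
      apply HasSum.mul_left
      rw [fourierKernel, add_sub_cancel_left]
      exact Complex.hasSum_ofReal.2 (Summable.of_norm_bounded (hsum.mul_left 2)
        fun k => norm_fourierKernel_term_le a z (hnorm θ) (k + 1)).hasSum)
  simp_rw [integral_exp_pow_mul_fourierKernel_term] at hS
  have hK := continuous_fourierKernel ha hcont hnorm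
  have hsplit : ∀ θ : ℝ, Complex.exp (θ * Complex.I) ^ n *
      (fourierKernel a z (Complex.exp (θ * Complex.I)) : ℂ) =
      Complex.exp (θ * Complex.I) ^ n *
        ((fourierKernel a z (Complex.exp (θ * Complex.I)) - a 0 : ℝ) : ℂ) +
      a 0 * (Complex.exp (θ * Complex.I) ^ n * conj (Complex.exp (θ * Complex.I)) ^ 0) := by
    intro θ; push_cast; ring
  simp_rw [hsplit]
  rw [intervalIntegral.integral_add, intervalIntegral.integral_const_mul,
    integral_exp_pow_mul_conj_pow]
  · rcases n with _ | n
    · simp only [Nat.right_eq_add, Nat.add_eq_zero_iff, one_ne_zero, and_false, if_false] at hS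
      rw [hS.unique hasSum_zero]
      simp
      ring
    · have h1 := hasSum_single (f := fun k => if n + 1 = k + 1 then
        2 * (Real.pi : ℂ) * (a (k + 1) * z ^ (n + 1)) else 0) n
        (fun k hk => if_neg (by omega))
      rw [hS.unique h1]
      simp
  · refine Continuous.intervalIntegrable (Continuous.mul (by fun_prop) ?_) _ _
    exact Complex.continuous_ofReal.comp (hK.sub continuous_const)
  · exact (by fun_prop : Continuous _).intervalIntegrable _ _

/-! ### Maximum principles. -/

/-- A harmonic function with a local maximum is locally constant. -/
theorem InnerProductSpace.HarmonicAt.eventually_eq_of_isLocalMax {g : ℂ → ℝ} {c : ℂ}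
    (hg : HarmonicAt g c) (hmax : IsLocalMax g c) : ∀ᶠ ζ in 𝓝 c, g ζ = g c := by
  obtain ⟨ε, hε, hball⟩ := Metric.eventually_nhds_iff_ball.1 hg.eventually
  obtain ⟨F, hF, hFg⟩ := HarmonicOnNhd.exists_analyticOnNhd_ball_re_eq hball
  have hnear := ball_mem_nhds c hε
  have hc := mem_ball_self hε (x := c)
  have hd : ∀ᶠ ζ in 𝓝 c, DifferentiableAt ℂ (fun ζ => Complex.exp (F ζ)) ζ := by
    filter_upwards [hnear] with ζ hζ
    exact (hF ζ hζ).differentiableAt.cexp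
  -- With `g = Re F`, the norm of `exp F` is `exp g`, so the maximum modulus principle applies.
  have hm : IsLocalMax (norm ∘ fun ζ => Complex.exp (F ζ)) c := by
    filter_upwards [hnear, hmax] with ζ hζ hle
    simp only [Function.comp_apply, Complex.norm_exp, Real.exp_le_exp]
    exact (hFg hζ).trans_le (hle.trans_eq (hFg hc).symm)
  filter_upwards [hnear, Complex.eventually_eq_of_isLocalMax_norm hd hm] with ζ hζ h
  have h2 := congrArg norm h
  simp only [Complex.norm_exp, Real.exp_eq_exp] at h2
  exact (hFg hζ).symm.trans (h2.trans (hFg hc))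

/-- The weak maximum principle on a closed annulus. -/
theorem exists_norm_eq_le_of_harmonicOnNhd_annulus {g : ℂ → ℝ} {a b : ℝ} (ha : 0 < a)
    (hg : HarmonicOnNhd g {ζ | a ≤ ‖ζ‖ ∧ ‖ζ‖ ≤ b}) {ζ : ℂ} (hζ : a ≤ ‖ζ‖ ∧ ‖ζ‖ ≤ b) :
    ∃ ξ : ℂ, (‖ξ‖ = a ∨ ‖ξ‖ = b) ∧ g ζ ≤ g ξ := by
  set B : Set ℂ := {ζ | a ≤ ‖ζ‖ ∧ ‖ζ‖ ≤ b} with hB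
  have hBc : IsCompact B := by
    refine (isCompact_closedBall (0 : ℂ) b).of_isClosed_subset
      ((isClosed_le continuous_const continuous_norm).inter
        (isClosed_le continuous_norm continuous_const)) fun z hz => ?_
    simpa using hz.2
  obtain ⟨x, hxB, hx⟩ := hBc.exists_isMaxOn ⟨ζ, hζ⟩ hg.continuousOn
  -- Among all maximum points take one of largest modulus. Were it interior, `g` would be constant
  -- near it, and moving radially outwards would give a maximum point of larger modulus. No
  -- connectedness argument is needed.
  have hcl : IsCompact (B ∩ g ⁻¹' {g x}) :=
    hBc.of_isClosed_subset (hg.continuousOn.preimage_isClosed_of_isClosed hBc.isClosed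
      isClosed_singleton) Set.inter_subset_left
  obtain ⟨ξ, ⟨hξB, hξx⟩, hξ⟩ := hcl.exists_isMaxOn ⟨x, hxB, rfl⟩ continuous_norm.continuousOn
  refine ⟨ξ, ?_, (hx hζ).trans_eq (Set.mem_singleton_iff.1 hξx).symm⟩
  by_contra! hcon
  have h1 : a < ‖ξ‖ := lt_of_le_of_ne hξB.1 hcon.1.symm
  have h2 : ‖ξ‖ < b := lt_of_le_of_ne hξB.2 hcon.2
  have hnhds : ∀ᶠ η in 𝓝 ξ, η ∈ B := by
    filter_upwards [continuous_norm.continuousAt.eventually (lt_mem_nhds h1),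
      continuous_norm.continuousAt.eventually (gt_mem_nhds h2)] with η h3 h4
    exact ⟨le_of_lt h3, le_of_lt h4⟩
  have hconst := (hg ξ hξB).eventually_eq_of_isLocalMax (by
    filter_upwards [hnhds] with η hη
    exact (hx hη).trans_eq (Set.mem_singleton_iff.1 hξx).symm)
  have htend : Tendsto (fun t : ℝ => (t : ℂ) * ξ) (𝓝[>] 1) (𝓝 ξ) := by
    have : Tendsto (fun t : ℝ => (t : ℂ) * ξ) (𝓝 1) (𝓝 (((1 : ℝ) : ℂ) * ξ)) :=
      Continuous.tendsto (by fun_prop) 1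
    rw [Complex.ofReal_one, one_mul] at this
    exact this.mono_left nhdsWithin_le_nhds
  obtain ⟨t, ht1, ht2, ht3⟩ := ((eventually_mem_nhdsWithin).and
    (htend.eventually (hnhds.and hconst))).exists
  have h5 := hξ (show (t : ℂ) * ξ ∈ B ∩ g ⁻¹' {g x} from ⟨ht2, ht3.trans hξx⟩)
  have ht : (1 : ℝ) < t := ht1
  simp only [Set.mem_ofPred_eq, norm_mul, Complex.norm_real, Real.norm_eq_abs,
    abs_of_pos (one_pos.trans ht)] at h5
  nlinarith [ha.trans h1]

/-- The maximum principle for separately harmonic functions on a closed polyannulus contained in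
the open one. -/
theorem SeparatelyHarmonic.exists_norm_eq_le {r : ℝ} (hr0 : 0 < r) {m : ℕ}
    {u : (Fin m → ℂ) → ℝ} (hu : SeparatelyHarmonic r m u) {a b : ℝ} (hra : r < a) (hb1 : b < 1)
    {z : Fin m → ℂ} (hz : ∀ j, a ≤ ‖z j‖ ∧ ‖z j‖ ≤ b) (T : Finset (Fin m)) :
    ∃ z' : Fin m → ℂ, (∀ j, a ≤ ‖z' j‖ ∧ ‖z' j‖ ≤ b) ∧ (∀ j ∈ T, ‖z' j‖ = a ∨ ‖z' j‖ = b) ∧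
      u z ≤ u z' := by
  induction T using Finset.induction_on with
  | empty => exact ⟨z, hz, by simp, le_rfl⟩
  | insert i T hi ih =>
    obtain ⟨y, hy, hyT, hle⟩ := ih
    have hab : a ≤ b := (hz i).1.trans (hz i).2
    have hharm : HarmonicOnNhd (fun ζ => u (Function.update y i ζ))
        {ζ | a ≤ ‖ζ‖ ∧ ‖ζ‖ ≤ b} := by
      intro ζ hζ
      have h := hu (Function.update y i ζ) (fun j _ => by
        by_cases hj : j = i
        · subst hj
          rw [Function.update_self]
          exact ⟨hra.trans_le hζ.1, hζ.2.trans_lt hb1⟩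
        · rw [Function.update_of_ne hj]
          exact ⟨hra.trans_le (hy j).1, (hy j).2.trans_lt hb1⟩) i
      simpa using h
    -- Only coordinate `i` moves, so the coordinates already pushed to a boundary circle stay there.
    obtain ⟨ξ, hξ, hξle⟩ :=
      exists_norm_eq_le_of_harmonicOnNhd_annulus (hr0.trans hra) hharm (hy i)
    rw [Function.update_eq_self] at hξle
    refine ⟨Function.update y i ξ, fun j => ?_, fun j hj => ?_, hle.trans hξle⟩
    · by_cases hj : j = i
      · subst hj
        rw [Function.update_self]
        rcases hξ with h | h <;> rw [h] <;> exact ⟨by linarith, by linarith⟩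
      · rw [Function.update_of_ne hj]; exact hy j
    · by_cases hji : j = i
      · subst hji
        rw [Function.update_self]; exact hξ
      · rw [Function.update_of_ne hji]
        exact hyT j ((Finset.mem_insert.1 hj).resolve_left hji)

/-- The maximum principle for separately harmonic functions on the polyannulus. -/
theorem SeparatelyHarmonic.le_of_le_on_distinguishedBoundary {r : ℝ} (hr0 : 0 < r) (hr1 : r < 1)
    {m : ℕ} {u : (Fin m → ℂ) → ℝ} (hu : SeparatelyHarmonic r m u)
    (hc : ContinuousOn u (closure (Polyannulus r m))) {M : ℝ}
    (hM : ∀ z ∈ distinguishedBoundary r m, u z ≤ M) {z : Fin m → ℂ}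
    (hz : z ∈ closure (Polyannulus r m)) : u z ≤ M := by
  suffices h : ∀ z ∈ Polyannulus r m, u z ≤ M by
    exact ContinuousWithinAt.closure_le hz ((hc z hz).mono subset_closure)
      continuousWithinAt_const h
  intro z hz
  -- Harmonicity is known only in the open polyannulus, so the maximum principle is applied on `r +
  -- δ ≤ |z_j| ≤ 1 - δ`, and `δ → 0` by compactness.
  have hev : ∀ᶠ δ in 𝓝[>] (0 : ℝ), ∃ y ∈ closure (Polyannulus r m),
      (∀ j, ‖y j‖ = r + δ ∨ ‖y j‖ = 1 - δ) ∧ u z ≤ u y := by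
    have h1 : ∀ᶠ δ in 𝓝[>] (0 : ℝ), ∀ j, r + δ ≤ ‖z j‖ ∧ ‖z j‖ ≤ 1 - δ := by
      apply eventually_all.2 fun j => ?_
      have hj := hz j (Set.mem_univ j)
      have h2 : ∀ᶠ δ in 𝓝 (0 : ℝ), δ < min (‖z j‖ - r) (1 - ‖z j‖) :=
        gt_mem_nhds (lt_min (sub_pos.2 hj.1) (sub_pos.2 hj.2))
      filter_upwards [nhdsWithin_le_nhds h2] with δ hδ
      rw [lt_min_iff] at hδ
      constructor <;> linarith [hδ.1, hδ.2]
    filter_upwards [h1, self_mem_nhdsWithin] with δ hδ hδ0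
    have hδ0' : (0 : ℝ) < δ := hδ0
    obtain ⟨y, hy, hyb, hle⟩ := hu.exists_norm_eq_le hr0 (show r < r + δ by linarith)
      (show 1 - δ < 1 by linarith) hδ Finset.univ
    refine ⟨y, subset_closure fun j _ => ⟨?_, ?_⟩, fun j => hyb j (Finset.mem_univ j), hle⟩
    · linarith [(hy j).1]
    · linarith [(hy j).2]
  obtain ⟨δ, hδ0, hδ⟩ := exists_seq_forall_of_frequently
    (hev.frequently.filter_mono le_rfl)
  choose y hyK hyb hle using hδ
  obtain ⟨w, hw, φ, hφ, hlim⟩ := (isCompact_closure_polyannulus hr0 hr1 m).tendsto_subseq hyK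
  have hδφ : Tendsto (fun n => δ (φ n)) atTop (𝓝 0) :=
    (tendsto_nhds_of_tendsto_nhdsWithin hδ0).comp hφ.tendsto_atTop
  have hwb : w ∈ distinguishedBoundary r m := by
    intro j _
    rw [frontier_annulus hr0 hr1]
    -- The vanishing product encodes the alternative of the two circles in a form that survives the
    -- limit.
    have h1 : Tendsto (fun n => (‖y (φ n) j‖ - (r + δ (φ n))) * (‖y (φ n) j‖ - (1 - δ (φ n))))
        atTop (𝓝 ((‖w j‖ - (r + 0)) * (‖w j‖ - (1 - 0)))) := by
      have h2 := ((continuous_apply j).tendsto w).comp hlim |>.norm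
      exact (h2.sub (tendsto_const_nhds.add hδφ)).mul (h2.sub (tendsto_const_nhds.sub hδφ))
    have h3 : ∀ n, (‖y (φ n) j‖ - (r + δ (φ n))) * (‖y (φ n) j‖ - (1 - δ (φ n))) = 0 := by
      intro n
      rcases hyb (φ n) j with h | h <;> rw [h] <;> ring
    simp_rw [h3] at h1
    have h4 := tendsto_nhds_unique h1 tendsto_const_nhds
    rcases mul_eq_zero.1 h4 with h | h
    · left; linarith
    · right; linarith
  have hul : Tendsto (fun n => u (y (φ n))) atTop (𝓝 (u w)) :=
    (hc w hw).tendsto.comp (tendsto_nhdsWithin_iff.2 ⟨hlim, Eventually.of_forall fun n => hyK _⟩)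
  exact (ge_of_tendsto' hul fun n => hle _).trans (hM w hwb)

/-! ### Explicit solutions on one annulus. -/

noncomputable section

/-- The Fourier coefficients of the outer Poisson kernel at a point of modulus `ρ`, each divided by
the corresponding power of the point. -/
def outerCoeff (r ρ : ℝ) : ℕ → ℝ
  | 0 => Real.log (ρ / r) / Real.log (1 / r)
  | k + 1 => (1 - (r / ρ) ^ (2 * (k + 1))) / (1 - r ^ (2 * (k + 1)))

/-- The Fourier coefficients of the inner Poisson kernel at a point of modulus `ρ`, each divided by
the corresponding power of the point. -/
def innerCoeff (r ρ : ℝ) : ℕ → ℝ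
  | 0 => Real.log ρ / Real.log r
  | k + 1 => (r / ρ ^ 2) ^ (k + 1) * (1 - ρ ^ (2 * (k + 1))) / (1 - r ^ (2 * (k + 1)))

/-- The solution of the Dirichlet problem on the annulus with boundary values `z ^ n * ‖z‖ ^ (2 b)`.
-/
def annulusMonomial (r : ℝ) (n b : ℕ) (z : ℂ) : ℂ :=
  ((outerCoeff r ‖z‖ n + r ^ (n + 2 * b) * innerCoeff r ‖z‖ n : ℝ) : ℂ) * z ^ n

/-- A function on the closed annulus, harmonic in the interior and represented there by the Poisson
integral of its boundary values. -/
structure AnnulusPoisson (r : ℝ) (h : ℂ → ℂ) : Prop where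
  continuousOn : ContinuousOn h (closure (Annulus r))
  harmonic : HarmonicOnNhd h (Annulus r)
  eq_integral : ∀ z ∈ Annulus r, h z =
    (2 * Real.pi : ℂ)⁻¹ * (∫ θ in Set.Icc (0 : ℝ) (2 * Real.pi), h (Complex.exp (θ * Complex.I)) *
      (outerPoissonKernel r z (Complex.exp (θ * Complex.I)) : ℂ)) +
    (2 * Real.pi : ℂ)⁻¹ * (∫ θ in Set.Icc (0 : ℝ) (2 * Real.pi),
      h (r * Complex.exp (θ * Complex.I)) *
      (innerPoissonKernel r z (Complex.exp (θ * Complex.I)) : ℂ))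

end

theorem outerPoissonKernel_eq (r : ℝ) (z w : ℂ) :
    outerPoissonKernel r z w = fourierKernel (outerCoeff r ‖z‖) z w := rfl

theorem innerPoissonKernel_eq (r : ℝ) (z w : ℂ) :
    innerPoissonKernel r z w = fourierKernel (innerCoeff r ‖z‖) z w := rfl

theorem one_sub_le_one_sub_pow {r : ℝ} (hr0 : 0 < r) (hr1 : r < 1) (k : ℕ) :
    1 - r ≤ 1 - r ^ (2 * (k + 1)) := by
  have := pow_le_of_le_one hr0.le hr1.le (show 2 * (k + 1) ≠ 0 by omega)
  linarith

theorem summable_outerCoeff {r ρ : ℝ} (hr0 : 0 < r) (hr : r < ρ) (hρ : ρ < 1) :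
    Summable fun k => |outerCoeff r ρ k| * ρ ^ k := by
  have hρ0 := hr0.trans hr
  have hr1 := hr.trans hρ
  rw [← summable_nat_add_iff 1]
  refine Summable.of_nonneg_of_le (fun k => by positivity) (fun k => ?_)
    (((summable_nat_add_iff 1).2 (summable_geometric_of_lt_one hρ0.le hρ)).mul_left (1 - r)⁻¹)
  refine mul_le_mul_of_nonneg_right ?_ (by positivity)
  have h1 := one_sub_le_one_sub_pow hr0 hr1 k
  have h2 : (r / ρ) ^ (2 * (k + 1)) ≤ 1 := pow_le_one₀ (by positivity) ((div_le_one hρ0).2 hr.le)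
  have h3 : 0 ≤ (r / ρ) ^ (2 * (k + 1)) := by positivity
  have h4 : 0 < 1 - r := sub_pos.2 hr1
  rw [outerCoeff, abs_of_nonneg (div_nonneg (by linarith) (by linarith)), ← one_div]
  exact div_le_div₀ zero_le_one (by linarith) h4 h1

/-- Since `(r / ρ²)^k ρ^k = (r / ρ)^k`, the comparison series is geometric of ratio `r / ρ`; the
remaining quotient is at most `1 / (1 - r)`. -/
theorem summable_innerCoeff {r ρ : ℝ} (hr0 : 0 < r) (hr : r < ρ) (hρ : ρ < 1) :
    Summable fun k => |innerCoeff r ρ k| * ρ ^ k := by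
  have hρ0 := hr0.trans hr
  have hr1 := hr.trans hρ
  rw [← summable_nat_add_iff 1]
  refine Summable.of_nonneg_of_le (fun k => by positivity) (fun k => ?_)
    (((summable_nat_add_iff 1).2 (summable_geometric_of_lt_one (r := r / ρ) (by positivity)
      ((div_lt_one hρ0).2 hr))).mul_left (1 - r)⁻¹)
  have h1 := one_sub_le_one_sub_pow hr0 hr1 k
  have h2 : ρ ^ (2 * (k + 1)) ≤ 1 := pow_le_one₀ hρ0.le hρ.le
  have h3 : 0 ≤ ρ ^ (2 * (k + 1)) := by positivity
  have h4 : 0 < 1 - r := sub_pos.2 hr1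
  have h5 : (r / ρ ^ 2) ^ (k + 1) * ρ ^ (k + 1) = (r / ρ) ^ (k + 1) := by
    rw [← mul_pow]; congr 1; field_simp
  have h6 : (1 - ρ ^ (2 * (k + 1))) / (1 - r ^ (2 * (k + 1))) ≤ (1 - r)⁻¹ := by
    rw [← one_div]; exact div_le_div₀ zero_le_one (by linarith) h4 h1
  have h7 : 0 ≤ (1 - ρ ^ (2 * (k + 1))) / (1 - r ^ (2 * (k + 1))) :=
    div_nonneg (by linarith) (by linarith)
  rw [innerCoeff, mul_div_assoc, abs_mul, abs_of_nonneg h7, abs_of_nonneg (by positivity),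
    mul_right_comm, h5, mul_comm]
  exact mul_le_mul_of_nonneg_right h6 (by positivity)

theorem continuous_outerPoissonKernel {r : ℝ} (hr0 : 0 < r) {z : ℂ} (hz : z ∈ Annulus r)
    {X : Type*} [TopologicalSpace X] {w : X → ℂ} (hw : Continuous w) (hw1 : ∀ x, ‖w x‖ = 1) :
    Continuous fun x => outerPoissonKernel r z (w x) :=
  continuous_fourierKernel (summable_outerCoeff hr0 hz.1 hz.2) hw hw1

theorem continuous_innerPoissonKernel {r : ℝ} (hr0 : 0 < r) {z : ℂ} (hz : z ∈ Annulus r)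
    {X : Type*} [TopologicalSpace X] {w : X → ℂ} (hw : Continuous w) (hw1 : ∀ x, ‖w x‖ = 1) :
    Continuous fun x => innerPoissonKernel r z (w x) :=
  continuous_fourierKernel (summable_innerCoeff hr0 hz.1 hz.2) hw hw1

theorem outerCoeff_one {r : ℝ} (hr0 : 0 < r) (hr1 : r < 1) (n : ℕ) : outerCoeff r 1 n = 1 := by
  rcases n with _ | n
  · exact div_self (Real.log_pos ((one_lt_div hr0).2 hr1)).ne'
  · rw [outerCoeff, div_one]
    exact div_self (by linarith [one_sub_le_one_sub_pow hr0 hr1 n])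

theorem outerCoeff_self {r : ℝ} (hr0 : 0 < r) (n : ℕ) : outerCoeff r r n = 0 := by
  rcases n with _ | n <;> simp [outerCoeff, div_self hr0.ne']

theorem innerCoeff_one (r : ℝ) (n : ℕ) : innerCoeff r 1 n = 0 := by
  rcases n with _ | n <;> simp [innerCoeff]

theorem innerCoeff_self {r : ℝ} (hr0 : 0 < r) (hr1 : r < 1) (n : ℕ) :
    r ^ n * innerCoeff r r n = 1 := by
  rcases n with _ | n
  · rw [pow_zero, one_mul]
    exact div_self (Real.log_neg hr0 hr1).ne
  · have : 1 - r ^ (2 * (n + 1)) ≠ 0 := by linarith [one_sub_le_one_sub_pow hr0 hr1 n]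
    rw [innerCoeff, mul_div_assoc, div_self this, mul_one, ← mul_pow, show r * (r / r ^ 2) = 1 by
      field_simp, one_pow]

theorem annulusMonomial_of_norm_eq_one {r : ℝ} (hr0 : 0 < r) (hr1 : r < 1) (n b : ℕ) {z : ℂ}
    (hz : ‖z‖ = 1) : annulusMonomial r n b z = z ^ n := by
  rw [annulusMonomial, hz, outerCoeff_one hr0 hr1, innerCoeff_one]
  simp

theorem annulusMonomial_of_norm_eq {r : ℝ} (hr0 : 0 < r) (hr1 : r < 1) (n b : ℕ) {z : ℂ}
    (hz : ‖z‖ = r) : annulusMonomial r n b z = (r : ℂ) ^ (2 * b) * z ^ n := by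
  rw [annulusMonomial, hz, outerCoeff_self hr0, zero_add, pow_add, mul_right_comm,
    innerCoeff_self hr0 hr1]
  simp

theorem continuousOn_annulusMonomial {r : ℝ} (hr0 : 0 < r) (n b : ℕ) :
    ContinuousOn (annulusMonomial r n b) {z | r ≤ ‖z‖ ∧ ‖z‖ ≤ 1} := by
  have h0 : ∀ z ∈ {z : ℂ | r ≤ ‖z‖ ∧ ‖z‖ ≤ 1}, ‖z‖ ≠ 0 := fun z hz => (hr0.trans_le hz.1).ne'
  have h1 : ∀ z ∈ {z : ℂ | r ≤ ‖z‖ ∧ ‖z‖ ≤ 1}, ‖z‖ / r ≠ 0 :=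
    fun z hz => div_ne_zero (h0 z hz) hr0.ne'
  have h2 : ∀ z ∈ {z : ℂ | r ≤ ‖z‖ ∧ ‖z‖ ≤ 1}, ‖z‖ ^ 2 ≠ 0 := fun z hz => pow_ne_zero 2 (h0 z hz)
  have ho : ContinuousOn (fun z : ℂ => outerCoeff r ‖z‖ n) {z | r ≤ ‖z‖ ∧ ‖z‖ ≤ 1} := by
    rcases n with _ | n <;> simp only [outerCoeff] <;> fun_prop (disch := assumption)
  have hi : ContinuousOn (fun z : ℂ => innerCoeff r ‖z‖ n) {z | r ≤ ‖z‖ ∧ ‖z‖ ≤ 1} := by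
    rcases n with _ | n <;> simp only [innerCoeff] <;> fun_prop (disch := assumption)
  unfold annulusMonomial
  exact (Complex.continuous_ofReal.comp_continuousOn (ho.add (continuousOn_const.mul hi))).mul
    (by fun_prop)

/-- Substituting `|ζ|² = ζ * conj ζ` turns the function into a combination of `ζ ^ n` and `(conj
ζ)⁻¹ ^ n`; for `n = 0` it is affine in `log |ζ|`. -/
theorem harmonicAt_annulusMonomial {r : ℝ} (hr0 : 0 < r) (hr1 : r < 1) (n b : ℕ) {z : ℂ}
    (hz : z ≠ 0) : HarmonicAt (annulusMonomial r n b) z := by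
  have hnear : ∀ᶠ ζ in 𝓝 z, ζ ≠ 0 := isOpen_ne.mem_nhds hz
  rcases n with _ | n
  · have hlog : HarmonicAt (fun ζ : ℂ => Real.log ‖ζ‖) z := analyticAt_id.harmonicAt_log_norm hz
    have h1 := (((hlog.const_smul (c := (Real.log (1 / r))⁻¹ + r ^ (2 * b) * (Real.log r)⁻¹)).add
      (harmonicAt_const (-Real.log r / Real.log (1 / r)))).comp_CLM Complex.ofRealCLM)
    refine (harmonicAt_congr_nhds ?_).1 h1
    filter_upwards [hnear] with ζ hζ
    simp only [Function.comp_apply, Pi.add_apply, Pi.smul_apply, smul_eq_mul, annulusMonomial,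
      outerCoeff, innerCoeff, pow_zero, mul_one, Complex.ofRealCLM_apply, zero_add]
    rw [Real.log_div (norm_ne_zero_iff.2 hζ) hr0.ne']
    congr 1
    ring
  · set D : ℝ := 1 - r ^ (2 * (n + 1)) with hD
    have hD0 : D ≠ 0 := by linarith [one_sub_le_one_sub_pow hr0 hr1 n]
    have hA : AnalyticAt ℂ (fun ζ : ℂ => ζ ^ (n + 1)) z := by fun_prop
    have hB : AnalyticAt ℂ (fun ζ : ℂ => ζ⁻¹ ^ (n + 1)) z := (analyticAt_inv hz).pow _
    set q : ℝ := r ^ (n + 1 + 2 * b) with hq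
    have h1 := (hA.harmonicAt.const_smul (c := (1 - q * r ^ (n + 1)) / D)).add
      (hB.harmonicAt_conj.const_smul (c := (q * r ^ (n + 1) - r ^ (2 * (n + 1))) / D))
    refine (harmonicAt_congr_nhds ?_).1 h1
    filter_upwards [hnear] with ζ hζ
    have hc : conj ζ ≠ 0 := (map_ne_zero _).2 hζ
    have hDc : (D : ℂ) ≠ 0 := by exact_mod_cast hD0
    have hns : (‖ζ‖ : ℂ) ^ 2 = ζ * conj ζ := by rw [Complex.mul_conj']
    simp only [Pi.add_apply, Pi.smul_apply, Complex.real_smul, annulusMonomial, outerCoeff,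
      innerCoeff, ← hD, ← hq, Pi.conj_apply]
    push_cast
    rw [pow_mul ((r : ℂ) / ‖ζ‖), div_pow, hns, pow_mul (‖ζ‖ : ℂ), hns, map_pow, map_inv₀,
      pow_mul (r : ℂ)]
    generalize conj ζ = c at hc
    simp only [div_pow, mul_pow, inv_pow]
    have h2 := pow_ne_zero (n + 1) hc
    have h3 := pow_ne_zero (n + 1) hζ
    generalize c ^ (n + 1) = c' at h2
    generalize ζ ^ (n + 1) = ζ' at h3
    field_simp
    ring

/-- At `w` and `r w` with `|w| = 1` the boundary values are `w ^ n` and `r ^ (n + 2 b) * w ^ n`, so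
the two integrals pick out the `n`-th Fourier coefficients of the kernels, which are those in the
definition. -/
theorem annulusPoisson_annulusMonomial {r : ℝ} (hr0 : 0 < r) (hr1 : r < 1) (n b : ℕ) :
    AnnulusPoisson r (annulusMonomial r n b) := by
  refine ⟨?_, fun z hz => ?_, fun z hz => ?_⟩
  · rw [closure_annulus hr0 hr1]; exact continuousOn_annulusMonomial hr0 n b
  · exact harmonicAt_annulusMonomial hr0 hr1 n b (norm_pos_iff.1 (hr0.trans hz.1))
  · have hpi : (Real.pi : ℂ) ≠ 0 := by exact_mod_cast Real.pi_ne_zero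
    have ho : ∀ θ : ℝ, annulusMonomial r n b (Complex.exp (θ * Complex.I)) =
        Complex.exp (θ * Complex.I) ^ n := fun θ =>
      annulusMonomial_of_norm_eq_one hr0 hr1 n b (Complex.norm_exp_ofReal_mul_I θ)
    have hi : ∀ θ : ℝ, annulusMonomial r n b (r * Complex.exp (θ * Complex.I)) =
        (r : ℂ) ^ (n + 2 * b) * Complex.exp (θ * Complex.I) ^ n := fun θ => by
      rw [annulusMonomial_of_norm_eq hr0 hr1]
      · ring
      · rw [norm_mul, Complex.norm_exp_ofReal_mul_I, Complex.norm_real, mul_one,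
          Real.norm_of_nonneg hr0.le]
    simp_rw [ho, hi, outerPoissonKernel_eq, innerPoissonKernel_eq, mul_assoc]
    rw [integral_const_mul, integral_Icc_eq_integral_Ioc, integral_Icc_eq_integral_Ioc,
      ← intervalIntegral.integral_of_le Real.two_pi_pos.le,
      ← intervalIntegral.integral_of_le Real.two_pi_pos.le,
      integral_exp_pow_mul_fourierKernel (summable_outerCoeff hr0 hz.1 hz.2),
      integral_exp_pow_mul_fourierKernel (summable_innerCoeff hr0 hz.1 hz.2), annulusMonomial]
    push_cast
    field_simp

/-- The kernels are real. Hence exponents with `a < b` reduce to `b ≤ a`, and only nonnegative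
Fourier coefficients are needed. -/
theorem AnnulusPoisson.conj {r : ℝ} {h : ℂ → ℂ} (hh : AnnulusPoisson r h) :
    AnnulusPoisson r fun z => conj (h z) := by
  refine ⟨Complex.continuous_conj.comp_continuousOn hh.continuousOn,
    fun z hz => (hh.harmonic z hz).comp_CLM Complex.conjCLE.toContinuousLinearMap,
    fun z hz => ?_⟩
  have h1 := congrArg (starRingEnd ℂ) (hh.eq_integral z hz)
  simpa only [map_add, map_mul, map_inv₀, Complex.conj_ofReal, ← integral_conj, map_ofNat]
    using h1

/-- Every monomial in `z` and `z̄` has a harmonic extension from the boundary to the annulus. -/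
theorem exists_annulusPoisson_eqOn_frontier {r : ℝ} (hr0 : 0 < r) (hr1 : r < 1) (a b : ℕ) :
    ∃ h : ℂ → ℂ, AnnulusPoisson r h ∧
      ∀ z ∈ frontier (Annulus r), h z = z ^ a * conj z ^ b := by
  wlog hab : b ≤ a generalizing a b
  · obtain ⟨h, hh, heq⟩ := this b a (by omega)
    refine ⟨_, hh.conj, fun z hz => ?_⟩
    rw [heq z hz]
    simp [mul_comm]
  obtain ⟨n, rfl⟩ := Nat.exists_eq_add_of_le' hab
  refine ⟨_, annulusPoisson_annulusMonomial hr0 hr1 n b, fun z hz => ?_⟩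
  rw [frontier_annulus hr0 hr1] at hz
  rw [pow_add, mul_assoc, ← mul_pow, Complex.mul_conj', ← pow_mul]
  rcases hz with hz | hz
  · rw [annulusMonomial_of_norm_eq hr0 hr1 n b hz, hz, mul_comm]
  · rw [annulusMonomial_of_norm_eq_one hr0 hr1 n b hz, hz]
    simp

/-! ### Poisson representation on the polyannulus and density of boundary values. -/

noncomputable section

/-- The Poisson integral of a complex-valued function. -/
def complexPoissonIntegral (r : ℝ) {m : ℕ} (f : (Fin m → ℂ) → ℂ) (z : Fin m → ℂ) : ℂ :=
  ∑ s : Finset (Fin m), (((2 * Real.pi) ^ m)⁻¹ : ℝ) *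
    ∫ θ in Set.univ.pi fun _ : Fin m => Set.Icc (0 : ℝ) (2 * Real.pi),
      f (boundaryPoint r s (torusPoint θ)) * (productPoissonKernel r s z (torusPoint θ) : ℂ)

/-- A function on the closed polyannulus, separately harmonic in the interior and represented there
by the Poisson integral of its values on the distinguished boundary. -/
structure PolyannulusPoisson (r : ℝ) (m : ℕ) (U : (Fin m → ℂ) → ℂ) : Prop where
  continuousOn : ContinuousOn U (closure (Polyannulus r m))
  harmonic : ∀ z ∈ Polyannulus r m, ∀ j, HarmonicAt (fun ζ => U (Function.update z j ζ)) (z j)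
  eq_integral : ∀ z ∈ Polyannulus r m, U z = complexPoissonIntegral r U z

end

section

variable {r : ℝ} {m : ℕ}

theorem continuous_productPoissonKernel (hr0 : 0 < r) (s : Finset (Fin m)) {z : Fin m → ℂ}
    (hz : z ∈ Polyannulus r m) :
    Continuous fun θ => productPoissonKernel r s z (torusPoint θ) := by
  unfold productPoissonKernel
  refine continuous_finsetProd _ fun j _ => ?_
  have hc : Continuous fun θ : Fin m → ℝ => torusPoint θ j :=
    (continuous_apply j).comp (continuous_torusPoint m)
  split_ifs
  · exact continuous_outerPoissonKernel hr0 (hz j (Set.mem_univ j)) hc fun θ => norm_torusPoint θ j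
  · exact continuous_innerPoissonKernel hr0 (hz j (Set.mem_univ j)) hc fun θ => norm_torusPoint θ j

theorem continuous_comp_boundaryPoint_torusPoint {X : Type*} [TopologicalSpace X]
    (hr0 : 0 < r) (hr1 : r < 1) (s : Finset (Fin m)) {f : (Fin m → ℂ) → X}
    (hf : ContinuousOn f (distinguishedBoundary r m)) :
    Continuous fun θ => f (boundaryPoint r s (torusPoint θ)) :=
  hf.comp_continuous ((continuous_boundaryPoint r s).comp (continuous_torusPoint m))
    fun θ => boundaryPoint_torusPoint_mem hr0 hr1 s θ

theorem Continuous.integrableOn_pi_Icc {E : Type*} [NormedAddCommGroup E]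
    {g : (Fin m → ℝ) → E} (hg : Continuous g) :
    IntegrableOn g (Set.univ.pi fun _ : Fin m => Set.Icc (0 : ℝ) (2 * Real.pi)) :=
  hg.continuousOn.integrableOn_compact (isCompact_univ_pi fun _ => isCompact_Icc)

theorem continuous_poissonIntegrand (hr0 : 0 < r) (hr1 : r < 1) (s : Finset (Fin m))
    {f : (Fin m → ℂ) → ℂ} (hf : ContinuousOn f (distinguishedBoundary r m)) {z : Fin m → ℂ}
    (hz : z ∈ Polyannulus r m) :
    Continuous fun θ => f (boundaryPoint r s (torusPoint θ)) *
      (productPoissonKernel r s z (torusPoint θ) : ℂ) :=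
  (continuous_comp_boundaryPoint_torusPoint hr0 hr1 s hf).mul
    (Complex.continuous_ofReal.comp (continuous_productPoissonKernel hr0 s hz))

namespace PolyannulusPoisson

theorem continuousOn_boundary {U : (Fin m → ℂ) → ℂ} (hU : PolyannulusPoisson r m U) :
    ContinuousOn U (distinguishedBoundary r m) :=
  hU.continuousOn.mono (distinguishedBoundary_subset_closure r m)

theorem zero : PolyannulusPoisson r m 0 :=
  ⟨continuousOn_const, fun _ _ _ => harmonicAt_const 0, fun z _ => by simp [complexPoissonIntegral]⟩

theorem add (hr0 : 0 < r) (hr1 : r < 1) {U V : (Fin m → ℂ) → ℂ} (hU : PolyannulusPoisson r m U)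
    (hV : PolyannulusPoisson r m V) : PolyannulusPoisson r m (U + V) := by
  refine ⟨hU.continuousOn.add hV.continuousOn,
    fun z hz j => (hU.harmonic z hz j).add (hV.harmonic z hz j), fun z hz => ?_⟩
  rw [Pi.add_apply, hU.eq_integral z hz, hV.eq_integral z hz]
  simp only [complexPoissonIntegral, ← Finset.sum_add_distrib, ← mul_add]
  refine Finset.sum_congr rfl fun s _ => ?_
  rw [← integral_add
    (continuous_poissonIntegrand hr0 hr1 s hU.continuousOn_boundary hz).integrableOn_pi_Icc
    (continuous_poissonIntegrand hr0 hr1 s hV.continuousOn_boundary hz).integrableOn_pi_Icc]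
  simp only [Pi.add_apply, add_mul]

theorem const_smul {U : (Fin m → ℂ) → ℂ} (c : ℂ) (hU : PolyannulusPoisson r m U) :
    PolyannulusPoisson r m (c • U) := by
  refine ⟨hU.continuousOn.const_smul c, fun z hz j =>
    (hU.harmonic z hz j).comp_CLM (ContinuousLinearMap.mul ℝ ℂ c), fun z hz => ?_⟩
  rw [Pi.smul_apply, hU.eq_integral z hz]
  simp only [complexPoissonIntegral, Pi.smul_apply, smul_eq_mul, mul_assoc, integral_const_mul,
    Finset.mul_sum]
  exact Finset.sum_congr rfl fun s _ => by ring

/-- Each factor is an outer plus an inner integral. Multiplying out gives one term per subset `s` of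
coordinates, and Fubini makes each term a single integral over the torus. -/
theorem prod {h : Fin m → ℂ → ℂ} (hh : ∀ j, AnnulusPoisson r (h j)) :
    PolyannulusPoisson r m fun z => ∏ j, h j (z j) := by
  refine ⟨?_, fun z hz j => ?_, fun z hz => ?_⟩
  · refine continuousOn_finsetProd _ fun j _ => ?_
    refine (hh j).continuousOn.comp (continuous_apply j).continuousOn fun z hz => ?_
    rw [Polyannulus, closure_pi_set] at hz
    exact hz j (Set.mem_univ j)
  · have h1 := ((hh j).harmonic (z j) (hz j (Set.mem_univ j))).comp_CLM
      (ContinuousLinearMap.mul ℝ ℂ (∏ i ∈ Finset.univ.erase j, h i (z i)))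
    convert h1 using 1
    ext ζ
    rw [← Finset.prod_erase_mul _ _ (Finset.mem_univ j)]
    simp only [Function.comp_apply, ContinuousLinearMap.mul_apply', Function.update_self]
    congr 1
    refine Finset.prod_congr rfl fun i hi => ?_
    rw [Function.update_of_ne (Finset.ne_of_mem_erase hi)]
  · simp only [(hh _).eq_integral _ (hz _ (Set.mem_univ _))]
    rw [Fintype.prod_add, complexPoissonIntegral]
    refine Finset.sum_congr rfl fun s _ => ?_
    -- Keeping `G` opaque exhibits the integrand as `∏ j, G j (θ j)`, the shape required by Fubini.
    obtain ⟨G, hG⟩ : ∃ G : Fin m → ℝ → ℂ, ∀ j t, G j t =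
        if j ∈ s then h j (Complex.exp (t * Complex.I)) *
            (outerPoissonKernel r (z j) (Complex.exp (t * Complex.I)) : ℂ)
          else h j (r * Complex.exp (t * Complex.I)) *
            (innerPoissonKernel r (z j) (Complex.exp (t * Complex.I)) : ℂ) :=
      ⟨_, fun _ _ => rfl⟩
    have hint : ∀ θ : Fin m → ℝ, (∏ j, h j (boundaryPoint r s (torusPoint θ) j)) *
        (productPoissonKernel r s z (torusPoint θ) : ℂ) = ∏ j, G j (θ j) := by
      intro θ
      rw [productPoissonKernel, Complex.ofReal_prod, ← Finset.prod_mul_distrib]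
      refine Finset.prod_congr rfl fun j _ => ?_
      simp only [boundaryPoint, torusPoint, hG]
      split_ifs <;> rfl
    simp_rw [hint]
    rw [volume_pi, Measure.restrict_pi_pi, integral_fintype_prod_eq_prod]
    have hcomp : ∀ F : Fin m → ℂ, ∏ j, F j = (∏ j ∈ s, F j) * ∏ j ∈ sᶜ, F j :=
      fun F => (Finset.prod_mul_prod_compl s F).symm
    have hconst : ((((2 * Real.pi) ^ m)⁻¹ : ℝ) : ℂ) = ∏ _j : Fin m, (2 * Real.pi : ℂ)⁻¹ := by
      simp [← inv_pow, mul_comm]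
    rw [hconst, ← Finset.prod_mul_distrib, hcomp]
    congr 1
    · exact Finset.prod_congr rfl fun j hj => by simp only [hG, if_pos hj]
    · exact Finset.prod_congr rfl fun j hj => by simp only [hG, if_neg (Finset.mem_compl.1 hj)]

/-- Boundary values of functions represented by Poisson integrals are dense. -/
theorem exists_norm_sub_lt (hr0 : 0 < r) (hr1 : r < 1) {f : (Fin m → ℂ) → ℂ}
    (hf : ContinuousOn f (distinguishedBoundary r m)) {ε : ℝ} (hε : 0 < ε) :
    ∃ U, PolyannulusPoisson r m U ∧ ∀ z ∈ distinguishedBoundary r m, ‖U z - f z‖ < ε := by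
  have : CompactSpace (distinguishedBoundary r m) :=
    isCompact_iff_compactSpace.1 (isCompact_distinguishedBoundary hr0 hr1 m)
  let coord : Fin m → C(distinguishedBoundary r m, ℂ) := fun j => 
    ⟨fun z => z.1 j, (continuous_apply j).comp continuous_subtype_val⟩
  let S : Set C(distinguishedBoundary r m, ℂ) := Set.range coord
  let A : StarSubalgebra ℂ C(distinguishedBoundary r m, ℂ) := StarAlgebra.adjoin ℂ S
  have hsep : A.SeparatesPoints := by
    intro x y hxy
    have hne : ∃ j, x.1 j ≠ y.1 j := by
      by_contra! h
      exact hxy (Subtype.ext (funext h))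
    obtain ⟨j, hj⟩ := hne
    exact ⟨coord j, ⟨coord j, StarAlgebra.subset_adjoin ℂ S ⟨j, rfl⟩, rfl⟩, hj⟩
  have htop := ContinuousMap.starSubalgebra_topologicalClosure_eq_top_of_separatesPoints A hsep
  let F : C(distinguishedBoundary r m, ℂ) := ⟨fun z => f z, hf.domRestrict⟩
  have hF : F ∈ closure (A : Set C(distinguishedBoundary r m, ℂ)) := by
    rw [← StarSubalgebra.topologicalClosure_coe, htop]
    trivial
  obtain ⟨G, hGA, hG⟩ := Metric.mem_closure_iff.1 hF ε hε
  have hmono : ∀ G ∈ Submonoid.closure (S ∪ star S), ∃ a b : Fin m → ℕ,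
      ∀ z : distinguishedBoundary r m, G z = ∏ j, z.1 j ^ a j * conj (z.1 j) ^ b j := by
    intro G hG
    induction hG using Submonoid.closure_induction with
    | mem G hG =>
      rcases hG with ⟨j, rfl⟩ | ⟨j, hj⟩
      · refine ⟨Pi.single j 1, 0, fun z => ?_⟩
        rw [Finset.prod_eq_single j]
        · simp [coord]
        · intro i _ hi; simp [hi]
        · simp
      · refine ⟨0, Pi.single j 1, fun z => ?_⟩
        rw [← star_star G, ← hj, Finset.prod_eq_single j]
        · simp [coord]
        · intro i _ hi; simp [hi]
        · simp
    | one => exact ⟨0, 0, fun z => by simp⟩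
    | mul G H _ _ hG hH =>
      obtain ⟨a, b, h1⟩ := hG
      obtain ⟨c, d, h2⟩ := hH
      refine ⟨a + c, b + d, fun z => ?_⟩
      rw [ContinuousMap.mul_apply, h1, h2, ← Finset.prod_mul_distrib]
      refine Finset.prod_congr rfl fun j _ => ?_
      simp only [Pi.add_apply, pow_add]
      ring
  -- The star algebra generated by the coordinates is the span of monomials in them and their
  -- conjugates, so it suffices to extend monomials.
  have hspan : G ∈ Submodule.span ℂ (Submonoid.closure (S ∪ star S) :
      Set C(distinguishedBoundary r m, ℂ)) := by
    rw [← Algebra.adjoin_eq_span, ← StarAlgebra.adjoin_toSubalgebra]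
    exact hGA
  have hext : ∃ U, PolyannulusPoisson r m U ∧ ∀ z : distinguishedBoundary r m, U z = G z := by
    clear hG hGA
    induction hspan using Submodule.span_induction with
    | mem G hG =>
      obtain ⟨a, b, hab⟩ := hmono G hG
      choose h hh heq using fun j => exists_annulusPoisson_eqOn_frontier hr0 hr1 (a j) (b j)
      refine ⟨_, prod hh, fun z => ?_⟩
      rw [hab]
      exact Finset.prod_congr rfl fun j _ => heq j _ (z.2 j (Set.mem_univ j))
    | zero => exact ⟨0, zero, fun z => rfl⟩
    | add G H _ _ hG hH =>
      obtain ⟨U, hU, hUG⟩ := hG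
      obtain ⟨V, hV, hVH⟩ := hH
      exact ⟨U + V, hU.add hr0 hr1 hV, fun z => by simp [hUG, hVH]⟩
    | smul c G _ hG =>
      obtain ⟨U, hU, hUG⟩ := hG
      exact ⟨c • U, hU.const_smul c, fun z => by simp [hUG]⟩
  obtain ⟨U, hU, hUG⟩ := hext
  refine ⟨U, hU, fun z hz => ?_⟩
  have h1 := (ContinuousMap.dist_apply_le_dist (f := F) (g := G) ⟨z, hz⟩).trans_lt hG
  rw [dist_comm, dist_eq_norm, ← hUG] at h1
  exact h1

theorem separatelyHarmonic_re {U : (Fin m → ℂ) → ℂ} (hU : PolyannulusPoisson r m U) :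
    SeparatelyHarmonic r m fun z => (U z).re :=
  fun z hz j => (hU.harmonic z hz j).comp_CLM Complex.reCLM

theorem re_eq_poissonIntegral (hr0 : 0 < r) (hr1 : r < 1) {U : (Fin m → ℂ) → ℂ}
    (hU : PolyannulusPoisson r m U) {z : Fin m → ℂ} (hz : z ∈ Polyannulus r m) :
    (U z).re = poissonIntegral r (fun z => (U z).re) z := by
  rw [hU.eq_integral z hz, complexPoissonIntegral, poissonIntegral, Complex.re_sum]
  refine Finset.sum_congr rfl fun s _ => ?_
  rw [Complex.re_ofReal_mul, ← Complex.reCLM_apply, ← Complex.reCLM.integral_comp_comm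
    (continuous_poissonIntegrand hr0 hr1 s hU.continuousOn_boundary hz).integrableOn_pi_Icc]
  simp only [Complex.reCLM_apply, Complex.re_mul_ofReal]

end PolyannulusPoisson

end

/-! ### Uniqueness, passage to the limit and the main theorem. -/

section

variable {r : ℝ} {m : ℕ}

theorem SeparatelyHarmonic.sub {u v : (Fin m → ℂ) → ℝ} (hu : SeparatelyHarmonic r m u)
    (hv : SeparatelyHarmonic r m v) : SeparatelyHarmonic r m (u - v) :=
  fun z hz j => (hu z hz j).sub (hv z hz j)

/-- The difference of two continuous separately harmonic functions is controlled on the closed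
polyannulus by its size on the distinguished boundary. -/
theorem SeparatelyHarmonic.abs_sub_le (hr0 : 0 < r) (hr1 : r < 1) {u v : (Fin m → ℂ) → ℝ}
    (hu : SeparatelyHarmonic r m u) (huc : ContinuousOn u (closure (Polyannulus r m)))
    (hv : SeparatelyHarmonic r m v) (hvc : ContinuousOn v (closure (Polyannulus r m))) {M : ℝ}
    (hM : ∀ z ∈ distinguishedBoundary r m, |u z - v z| ≤ M) {z : Fin m → ℂ}
    (hz : z ∈ closure (Polyannulus r m)) : |u z - v z| ≤ M :=
  abs_sub_le_iff.2
    ⟨(hu.sub hv).le_of_le_on_distinguishedBoundary hr0 hr1 (huc.sub hvc)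
      (fun w hw => (abs_sub_le_iff.1 (hM w hw)).1) hz,
    (hv.sub hu).le_of_le_on_distinguishedBoundary hr0 hr1 (hvc.sub huc)
      (fun w hw => (abs_sub_le_iff.1 (hM w hw)).2) hz⟩

theorem SolvesDirichlet.eqOn_closure (hr0 : 0 < r) (hr1 : r < 1) {f u v : (Fin m → ℂ) → ℝ}
    (hu : SolvesDirichlet r m f u) (hv : SolvesDirichlet r m f v) :
    Set.EqOn v u (closure (Polyannulus r m)) := by
  intro z hz
  have h := hv.harmonic.abs_sub_le hr0 hr1 hv.continuousOn hu.harmonic hu.continuousOn (M := 0)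
    (fun w hw => by rw [hv.eqOn_boundary hw, hu.eqOn_boundary hw, sub_self, abs_zero]) hz
  exact sub_eq_zero.1 (abs_nonpos_iff.1 h)

/-- Freezing all coordinates but one reduces this to uniform limits on a small closed disc in the
annulus. -/
theorem SeparatelyHarmonic.of_tendstoUniformlyOn {u : (Fin m → ℂ) → ℝ}
    {v : ℕ → (Fin m → ℂ) → ℝ} (hv : ∀ n, SeparatelyHarmonic r m (v n))
    (h : TendstoUniformlyOn v u atTop (Polyannulus r m)) : SeparatelyHarmonic r m u := by
  intro z hz j
  obtain ⟨R, hR, hball⟩ := nhds_basis_closedBall.mem_iff.1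
    ((isOpen_annulus r).mem_nhds (hz j (Set.mem_univ j)))
  have hmem : ∀ ζ ∈ closedBall (z j) R, Function.update z j ζ ∈ Polyannulus r m := by
    intro ζ hζ i _
    by_cases hi : i = j
    · subst hi
      rw [Function.update_self]; exact hball hζ
    · rw [Function.update_of_ne hi]; exact hz i (Set.mem_univ i)
  refine TendstoUniformlyOn.harmonicAt hR (v := fun n ζ => v n (Function.update z j ζ)) ?_ ?_
  · intro n ζ hζ
    simpa using hv n _ (hmem ζ hζ) j
  · exact (h.comp (fun ζ => Function.update z j ζ)).mono hmem

theorem tendsto_poissonIntegral (hr0 : 0 < r) (hr1 : r < 1) {f : (Fin m → ℂ) → ℝ}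
    {g : ℕ → (Fin m → ℂ) → ℝ} (hg : ∀ n, ContinuousOn (g n) (distinguishedBoundary r m))
    (hf : ContinuousOn f (distinguishedBoundary r m))
    (h : TendstoUniformlyOn g f atTop (distinguishedBoundary r m)) {z : Fin m → ℂ}
    (hz : z ∈ Polyannulus r m) :
    Tendsto (fun n => poissonIntegral r (g n) z) atTop (𝓝 (poissonIntegral r f z)) := by
  refine tendsto_finsetSum _ fun s _ => Tendsto.const_mul _ ?_
  have hk := continuous_productPoissonKernel hr0 s hz
  have hfc := continuous_comp_boundaryPoint_torusPoint hr0 hr1 s hf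
  have hmem := fun θ => boundaryPoint_torusPoint_mem hr0 hr1 s (m := m) θ
  refine tendsto_integral_filter_of_dominated_convergence
    (fun θ => (|f (boundaryPoint r s (torusPoint θ))| + 1) *
      |productPoissonKernel r s z (torusPoint θ)|) ?_ ?_ ?_ ?_
  · exact Eventually.of_forall fun n => ((continuous_comp_boundaryPoint_torusPoint hr0 hr1 s
      (hg n)).mul hk).aestronglyMeasurable
  · filter_upwards [Metric.tendstoUniformlyOn_iff.1 h 1 one_pos] with n hn
    refine Eventually.of_forall fun θ => ?_
    rw [norm_mul, Real.norm_eq_abs, Real.norm_eq_abs]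
    refine mul_le_mul_of_nonneg_right ?_ (abs_nonneg _)
    have h1 := hn _ (hmem θ)
    rw [Real.dist_eq, abs_sub_comm] at h1
    have h2 := abs_sub_abs_le_abs_sub (g n (boundaryPoint r s (torusPoint θ)))
      (f (boundaryPoint r s (torusPoint θ)))
    linarith
  · exact ((hfc.abs.add continuous_const).mul hk.abs).integrableOn_pi_Icc
  · exact Eventually.of_forall fun θ => (h.tendsto_at (hmem θ)).mul_const _

end

theorem mainTheorem2 (r : ℝ) (hr0 : 0 < r) (hr1 : r < 1) (m : ℕ) (hm : 2 ≤ m)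
    (f : (Fin m → ℂ) → ℝ) (hf : ContinuousOn f (distinguishedBoundary r m)) :
    ∃ u : (Fin m → ℂ) → ℝ,
      SolvesDirichlet r m f u ∧
      (∀ v : (Fin m → ℂ) → ℝ, SolvesDirichlet r m f v →
        Set.EqOn v u (closure (Polyannulus r m))) ∧
      (∀ z ∈ Polyannulus r m, u z = poissonIntegral r f z) := by
  have hfc : ContinuousOn (fun z => (f z : ℂ)) (distinguishedBoundary r m) :=
    Complex.continuous_ofReal.comp_continuousOn hf
  choose U hU hUf using fun n : ℕ =>
    PolyannulusPoisson.exists_norm_sub_lt hr0 hr1 hfc (Nat.one_div_pos_of_nat (n := n) (α := ℝ))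
  set v : ℕ → (Fin m → ℂ) → ℝ := fun n z => (U n z).re with hv
  have hvc : ∀ n, ContinuousOn (v n) (closure (Polyannulus r m)) := fun n =>
    Complex.continuous_re.comp_continuousOn (hU n).continuousOn
  have hvh : ∀ n, SeparatelyHarmonic r m (v n) := fun n => (hU n).separatelyHarmonic_re
  have hvf : ∀ n, ∀ z ∈ distinguishedBoundary r m, |v n z - f z| < 1 / ((n : ℝ) + 1) := by
    intro n z hz
    refine lt_of_le_of_lt ?_ (hUf n z hz)
    simpa [hv] using Complex.abs_re_le_norm (U n z - f z)
  have hlim0 := tendsto_one_div_add_atTop_nhds_zero_nat (𝕜 := ℝ)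
  have hvfu : TendstoUniformlyOn v f atTop (distinguishedBoundary r m) := by
    rw [Metric.tendstoUniformlyOn_iff]
    intro ε hε
    filter_upwards [hlim0.eventually (gt_mem_nhds hε)] with n hn z hz
    rw [dist_comm]
    exact (hvf n z hz).trans hn
  -- The maximum principle carries the Cauchy estimate from the distinguished boundary to the whole
  -- closure.
  have hcauchy : UniformCauchySeqOn v atTop (closure (Polyannulus r m)) := by
    rw [Metric.uniformCauchySeqOn_iff]
    intro ε hε
    obtain ⟨N, hN⟩ := Metric.uniformCauchySeqOn_iff.1 hvfu.uniformCauchySeqOn (ε / 2) (half_pos hε)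
    refine ⟨N, fun k hk n hn z hz => ?_⟩
    exact ((hvh k).abs_sub_le hr0 hr1 (hvc k) (hvh n) (hvc n)
      (fun w hw => (hN k hk n hn w hw).le) hz).trans_lt (half_lt_self hε)
  have hptw : ∀ z ∈ closure (Polyannulus r m), ∃ y, Tendsto (fun n => v n z) atTop (𝓝 y) :=
    fun z hz => cauchySeq_tendsto_of_complete (hcauchy.cauchySeq hz)
  -- The values of `u` outside the closed polyannulus are arbitrary.
  choose! u hu using hptw
  have hunif : TendstoUniformlyOn v u atTop (closure (Polyannulus r m)) :=
    hcauchy.tendstoUniformlyOn_of_tendsto hu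
  have hsolves : SolvesDirichlet r m f u :=
    { continuousOn := hunif.continuousOn (Eventually.of_forall hvc).frequently
      harmonic := .of_tendstoUniformlyOn hvh (hunif.mono subset_closure)
      eqOn_boundary := fun z hz => tendsto_nhds_unique
        (hu z (distinguishedBoundary_subset_closure r m hz)) (hvfu.tendsto_at hz) }
  refine ⟨u, hsolves, fun w hw => hsolves.eqOn_closure hr0 hr1 hw, fun z hz => ?_⟩
  have h1 := tendsto_poissonIntegral hr0 hr1 (fun n => (hvc n).mono
    (distinguishedBoundary_subset_closure r m)) hf hvfu hz
  have h2 : ∀ n, poissonIntegral r (v n) z = v n z := fun n =>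
    ((hU n).re_eq_poissonIntegral hr0 hr1 hz).symm
  simp_rw [h2] at h1
  exact tendsto_nhds_unique (hu z (subset_closure hz)) h1
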